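/- Let $d\ge 2$ and $n\ge 0$ be integers. Let $\mathcal H_n^d$ be the space of real polynomials on $\mathbb R^d$ that are homogeneous of degree $n$ and harmonic ($\Delta Y=\partial_1^2Y+\dots+\partial_d^2Y=0$), let $d\sigma$ be the (unnormalized) surface area measure on the unit sphere $\mathbb S^{d-1}\subset\mathbb R^d$, and let $\omega_m=2\pi^{m/2}/\Gamma(m/2)$ be the surface area of $\mathbb S^{m-1}$ (so $\omega_1=2$). For $\lambda>0$ let $C_n^\lambda$ be the Gegenbauer polynomial $$C_n^\lambda(t)=\frac{(\lambda)_n2^n}{n!}\sum_{j=0}^{\lfloor n/2\rfloor}\frac{(-\frac n2)_j(\frac{1-n}2)_j}{j!\,(1-n-\lambda)_j}\,t^{n-2j},\qquad (a)_j=a(a+1)\cdots(a+j-1).$$ Put $\lambda=\frac{d-2}2$; for $d=2$, where $\lambda=0$, the quotient $C_n^0(t)/C_n^0(1)$ denotes the limit $\lim_{\mu\to0+}C_n^\mu(t)/C_n^\mu(1)=T_n(t)$, the Chebyshev polynomial of the first kind ($T_n(\cos\theta)=\cos n\theta$). Let $f$ be a real-valued measurable function on $(-1,1)$ (its values at $\pm1$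 may be chosen arbitrarily) such that $$\int_{-1}^1|f(t)|\,(1-t^2)^{\frac{d-3}2}\,dt<\infty .$$ Then the integral defining $$\lambda_n(f):=\omega_{d-1}\int_{-1}^1 f(t)\,\frac{C_n^\lambda(t)}{C_n^\lambda(1)}\,(1-t^2)^{\frac{d-3}2}\,dt$$ converges absolutely, and for every $Y_n\in\mathcal H_n^d$ and every $x\in\mathbb S^{d-1}$ the function $y\mapsto f(\langle x,y\rangle)Y_n(y)$ is integrable on $\mathbb S^{d-1}$ and $$\int_{\mathbb S^{d-1}}f(\langle x,y\rangle)\,Y_n(y)\,d\sigma(y)=\lambda_n(f)\,Y_n(x).$$ -/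

import Mathlib

noncomputable section

namespace SphericalHarmonics

open MeasureTheory

/-- The Laplacian `Δ = ∂₁² + ⋯ + ∂_d²` on real polynomials in `d` variables. -/
def polyLaplacian (d : ℕ) : MvPolynomial (Fin d) ℝ →ₗ[ℝ] MvPolynomial (Fin d) ℝ :=
  ∑ i : Fin d, (MvPolynomial.pderiv i).toLinearMap ∘ₗ (MvPolynomial.pderiv i).toLinearMap

/-- The space `𝓗_n^d` of real harmonic polynomials on `ℝ^d`, homogeneous of degree `n`. -/
def harmonicSpace (d n : ℕ) : Submodule ℝ (MvPolynomial (Fin d) ℝ) :=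
  MvPolynomial.homogeneousSubmodule (Fin d) ℝ n ⊓ LinearMap.ker (polyLaplacian d)

/-- The unit sphere `𝕊^{d-1}` of the Euclidean space `ℝ^d`. -/
abbrev unitSphere (d : ℕ) : Set (EuclideanSpace ℝ (Fin d)) :=
  Metric.sphere (0 : EuclideanSpace ℝ (Fin d)) 1

/-- The surface area measure `σ` on `𝕊^{d-1}` (not normalized). -/
abbrev surfaceMeasure (d : ℕ) : Measure (unitSphere d) :=
  (volume : Measure (EuclideanSpace ℝ (Fin d))).toSphere

/-- The surface area `ω_d` of `𝕊^{d-1}`; in particular `ω_1 = 2`. -/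
def surfaceArea (d : ℕ) : ℝ :=
  (surfaceMeasure d).real Set.univ

/-- The Pochhammer symbol `(a)_k = a (a + 1) ⋯ (a + k - 1)`. -/
def pochhammer (a : ℝ) (k : ℕ) : ℝ :=
  (ascPochhammer ℝ k).eval a

/-- The Gegenbauer polynomial `C_n^μ` for `μ > 0`:
`C_n^μ(t) = ((μ)_n 2^n / n!) t^n ₂F₁(-n/2, (1-n)/2; 1-n-μ; 1/t²)`.
The hypergeometric series terminates after the index `⌊n/2⌋`; the factor `t^n` has been multiplied
into it, so that the formula also gives the value of the polynomial at `t = 0`. -/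
def gegenbauer (μ : ℝ) (n : ℕ) (t : ℝ) : ℝ :=
  pochhammer μ n * 2 ^ n / (n.factorial : ℝ) *
    ∑ j ∈ Finset.range (n / 2 + 1),
      pochhammer (-(n : ℝ) / 2) j * pochhammer ((1 - (n : ℝ)) / 2) j /
        ((j.factorial : ℝ) * pochhammer (1 - (n : ℝ) - μ) j) * t ^ (n - 2 * j)

/-- The quotient `C_n^μ(t) / C_n^μ(1)`, with `μ = (d - 2) / 2`, for `d ≥ 2`. If `d = 2`, then
`μ = 0` and the quotient stands for its limit as `μ → 0+`, the Chebyshev polynomial `T_n(t)`. -/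
def gegenbauerQuotient (d n : ℕ) (t : ℝ) : ℝ :=
  if d = 2 then (Polynomial.Chebyshev.T ℝ (n : ℤ)).eval t
  else gegenbauer (((d : ℝ) - 2) / 2) n t / gegenbauer (((d : ℝ) - 2) / 2) n 1

/-- The weight `(1 - t²)^{(d-3)/2}`. -/
def weight (d : ℕ) (t : ℝ) : ℝ :=
  (1 - t ^ 2) ^ (((d : ℝ) - 3) / 2)

/-- The constant
`λ_n(f) = ω_{d-1} ∫_{-1}^1 f(t) (C_n^μ(t) / C_n^μ(1)) (1 - t²)^{(d-3)/2} dt`, `μ = (d - 2) / 2`. -/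
def funkHeckeConstant (d n : ℕ) (f : ℝ → ℝ) : ℝ :=
  surfaceArea (d - 1) * ∫ t in Set.Ioo (-1 : ℝ) 1, f t * gegenbauerQuotient d n t * weight d t

end SphericalHarmonics

end

/-!
Let `P_n = C_n^λ / C_n^λ(1)` (`T_n` if `d = 2`). For `x` on the sphere and a spherical harmonic `Y`
of degree `n`, the function `y ↦ Y(y) - P_n(⟨x, y⟩) Y(x)` is orthogonal to every polynomial in
`⟨x, y⟩`, because the moments `∫ ⟨x, y⟩^k Y(y) dσ(y)` and
`Y(x) ω_{d-1} ∫ t^k P_n(t) (1 - t²)^{(d-3)/2} dt` satisfy the same recursion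
`(k + n + d - 1) M(n, k + 1) = k M(n, k - 1) + n M(n - 1, k)`.
On the sphere it is the divergence theorem (obtained from Gaussian integration by parts in polar
coordinates), combined with Euler's identity and the fact that the derivative of `Y` in the
direction `x` is harmonic of degree `n - 1`. On the interval it is integration by parts, combined
with `(1 - t²) P_n' = n (P_{n-1} - t P_n)`. The initial values `M(n, 0)` vanish for `n > 0`, since
`Y` and `P_n` are eigenfunctions of the spherical Laplacian and of the Gegenbauer operator. Finally,
a finite measure on a compact interval is determined by its moments, which replaces polynomials in
`⟨x, y⟩` by arbitrary integrable functions of `⟨x, y⟩`.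
-/

namespace SphericalHarmonics

section Gegenbauer

open Polynomial

/-- The coefficient of `X ^ i` in the Gegenbauer polynomial of degree `i + 2 * j`. -/
noncomputable def gegenbauerCoeff (μ : ℝ) (i j : ℕ) : ℝ :=
  (-1) ^ j * 2 ^ i * pochhammer μ (i + j) / (i.factorial * j.factorial)

/-- The Gegenbauer polynomial `C_n^μ = ∑_j (-1)^j (μ)_{n-j} (2X)^{n-2j} / (j! (n-2j)!)`. -/
noncomputable def gegenbauerPoly (μ : ℝ) (n : ℕ) : ℝ[X] :=
  ∑ j ∈ Finset.range (n / 2 + 1), monomial (n - 2 * j) (gegenbauerCoeff μ (n - 2 * j) j)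

theorem pochhammer_zero (a : ℝ) : pochhammer a 0 = 1 := by
  simp [pochhammer]

theorem pochhammer_succ (a : ℝ) (k : ℕ) : pochhammer a (k + 1) = pochhammer a k * (a + k) :=
  ascPochhammer_succ_eval k a

theorem pochhammer_pos {a : ℝ} (ha : 0 < a) (k : ℕ) : 0 < pochhammer a k :=
  ascPochhammer_pos k a ha

theorem pochhammer_neg_half_mul_pochhammer (i j : ℕ) {n : ℕ} (h : n = i + 2 * j) :
    pochhammer (-(n : ℝ) / 2) j * pochhammer ((1 - (n : ℝ)) / 2) j * (4 ^ j * i.factorial) =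
      n.factorial := by
  induction j generalizing i with
  | zero => simp [pochhammer_zero, h]
  | succ j ih =>
    have hn : (n : ℝ) = i + 2 * (j + 1) := by rw [h]; push_cast; ring
    rw [← ih (i + 2) (by omega), pochhammer_succ, pochhammer_succ, Nat.factorial_succ (i + 1),
      Nat.factorial_succ i, hn]
    push_cast
    ring

theorem pochhammer_one_sub_sub_mul_pochhammer (μ : ℝ) (i j : ℕ) {m : ℕ} (h : m = i + j) :
    pochhammer (1 - m - μ) j * pochhammer μ i = (-1) ^ j * pochhammer μ m := by
  induction j generalizing i with
  | zero => simp [pochhammer_zero, h]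
  | succ j ih =>
    have hm : (m : ℝ) = i + j + 1 := by rw [h]; push_cast; ring
    have ih := ih (i + 1) (by omega)
    rw [pochhammer_succ] at ih
    rw [pochhammer_succ, pow_succ]
    linear_combination -ih + pochhammer (1 - m - μ) j * pochhammer μ i * (-hm)

theorem gegenbauerCoeff_eq {μ : ℝ} (hμ : 0 < μ) (i j : ℕ) {n : ℕ} (h : n = i + 2 * j) :
    gegenbauerCoeff μ i j = pochhammer μ n * 2 ^ n / n.factorial *
      (pochhammer (-(n : ℝ) / 2) j * pochhammer ((1 - (n : ℝ)) / 2) j /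
        (j.factorial * pochhammer (1 - n - μ) j)) := by
  have hnum := pochhammer_neg_half_mul_pochhammer i j h
  have hden := pochhammer_one_sub_sub_mul_pochhammer μ (i + j) j (m := n) (by omega)
  have hden_ne : pochhammer (1 - n - μ) j ≠ 0 := by
    refine left_ne_zero_of_mul (b := pochhammer μ (i + j)) ?_
    rw [hden]
    exact mul_ne_zero (pow_ne_zero j (by norm_num)) (pochhammer_pos hμ n).ne'
  have hsign : ((-1 : ℝ) ^ j) * (-1) ^ j = 1 := by rw [← mul_pow]; norm_num
  have hpow : (2 : ℝ) ^ n = 2 ^ i * 4 ^ j := by rw [h, pow_add, pow_mul]; norm_num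
  rw [neg_div] at hnum ⊢
  rw [gegenbauerCoeff, hpow]
  field_simp
  linear_combination (-1) ^ j * (n.factorial : ℝ) * hden + pochhammer μ n * n.factorial * hsign
    - pochhammer μ n * hnum

theorem eval_gegenbauerPoly {μ : ℝ} (hμ : 0 < μ) (n : ℕ) (t : ℝ) :
    (gegenbauerPoly μ n).eval t = gegenbauer μ n t := by
  rw [gegenbauerPoly, eval_finsetSum, gegenbauer, Finset.mul_sum]
  refine Finset.sum_congr rfl fun j hj => ?_
  have hj : 2 * j ≤ n := by have := Finset.mem_range.1 hj; omega
  rw [eval_monomial, gegenbauerCoeff_eq hμ (n - 2 * j) j (n := n) (by omega), mul_assoc]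

theorem coeff_gegenbauerPoly_add (μ : ℝ) (i j : ℕ) {n : ℕ} (h : n = i + 2 * j) :
    (gegenbauerPoly μ n).coeff i = gegenbauerCoeff μ i j := by
  rw [gegenbauerPoly, finsetSum_coeff, Finset.sum_eq_single_of_mem j]
  · rw [show n - 2 * j = i by omega, coeff_monomial_same]
  · exact Finset.mem_range.2 (by omega)
  · intro k hk hkj
    have := Finset.mem_range.1 hk
    exact coeff_monomial_of_ne _ (by omega)

theorem coeff_gegenbauerPoly_eq_zero (μ : ℝ) {n i : ℕ} (h : ∀ j, n ≠ i + 2 * j) :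
    (gegenbauerPoly μ n).coeff i = 0 := by
  rw [gegenbauerPoly, finsetSum_coeff]
  refine Finset.sum_eq_zero fun j hj => coeff_monomial_of_ne _ ?_
  have := Finset.mem_range.1 hj
  have := h j
  omega

theorem gegenbauerCoeff_succ_left (μ : ℝ) (i j : ℕ) :
    (i + 1) * gegenbauerCoeff μ (i + 1) j = 2 * (μ + i + j) * gegenbauerCoeff μ i j := by
  rw [gegenbauerCoeff, gegenbauerCoeff, add_right_comm, pochhammer_succ, Nat.factorial_succ]
  push_cast
  field_simp
  ring

theorem gegenbauerCoeff_succ_right (μ : ℝ) (i j : ℕ) :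
    2 * (j + 1) * gegenbauerCoeff μ i (j + 1) = -((i + 1) * gegenbauerCoeff μ (i + 1) j) := by
  rw [gegenbauerCoeff, gegenbauerCoeff, add_right_comm, ← add_assoc, Nat.factorial_succ,
    Nat.factorial_succ]
  push_cast
  field_simp
  ring

theorem coeff_X_mul_derivative (p : ℝ[X]) (i : ℕ) :
    (X * derivative p).coeff i = i * p.coeff i := by
  cases i with
  | zero => simp
  | succ i => rw [coeff_X_mul, coeff_derivative, mul_comm]; push_cast; rfl

theorem X_mul_derivative_gegenbauerPoly_succ (μ : ℝ) (n : ℕ) :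
    X * derivative (gegenbauerPoly μ (n + 1)) =
      derivative (gegenbauerPoly μ n) + C (n + 1 : ℝ) * gegenbauerPoly μ (n + 1) := by
  ext i
  rw [coeff_X_mul_derivative, coeff_add, coeff_derivative, coeff_C_mul]
  by_cases h : ∃ j, n + 1 = i + 2 * j
  · obtain ⟨_ | j, h⟩ := h
    · have hi : (n : ℝ) + 1 = i := by exact_mod_cast h
      rw [coeff_gegenbauerPoly_eq_zero μ (n := n) (i := i + 1) (by omega), hi]
      ring
    · have hn : (n : ℝ) = i + 2 * j + 1 := by exact_mod_cast (by omega : n = i + 2 * j + 1)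
      rw [coeff_gegenbauerPoly_add μ i (j + 1) h,
        coeff_gegenbauerPoly_add μ (i + 1) j (n := n) (by omega), hn]
      linear_combination -gegenbauerCoeff_succ_right μ i j
  · push Not at h
    rw [coeff_gegenbauerPoly_eq_zero μ h, coeff_gegenbauerPoly_eq_zero μ (n := n) (i := i + 1)
      fun j hj => h (j + 1) (by omega)]
    ring

theorem derivative_gegenbauerPoly_succ (μ : ℝ) (n : ℕ) :
    derivative (gegenbauerPoly μ (n + 1)) =
      X * derivative (gegenbauerPoly μ n) + C (n + 2 * μ) * gegenbauerPoly μ n := by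
  ext i
  rw [coeff_derivative, coeff_add, coeff_X_mul_derivative, coeff_C_mul]
  by_cases h : ∃ j, n = i + 2 * j
  · obtain ⟨j, h⟩ := h
    have hn : (n : ℝ) = i + 2 * j := by exact_mod_cast h
    rw [coeff_gegenbauerPoly_add μ (i + 1) j (n := n + 1) (by omega),
      coeff_gegenbauerPoly_add μ i j h, hn]
    linear_combination gegenbauerCoeff_succ_left μ i j
  · push Not at h
    rw [coeff_gegenbauerPoly_eq_zero μ h, coeff_gegenbauerPoly_eq_zero μ (n := n + 1) (i := i + 1)
      fun j hj => h j (by omega)]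
    ring

theorem one_sub_X_sq_mul_derivative_gegenbauerPoly_succ (μ : ℝ) (n : ℕ) :
    (1 - X ^ 2) * derivative (gegenbauerPoly μ (n + 1)) =
      C (n + 2 * μ) * gegenbauerPoly μ n - C (n + 1 : ℝ) * X * gegenbauerPoly μ (n + 1) := by
  linear_combination derivative_gegenbauerPoly_succ μ n -
    X * X_mul_derivative_gegenbauerPoly_succ μ n

theorem gegenbauerPoly_succ_differential_equation (μ : ℝ) (n : ℕ) :
    (1 - X ^ 2) * derivative (derivative (gegenbauerPoly μ (n + 1)))
      - C (2 * μ + 1) * X * derivative (gegenbauerPoly μ (n + 1))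
      + C ((n + 1) * (n + 1 + 2 * μ)) * gegenbauerPoly μ (n + 1) = 0 := by
  have hladder := congrArg derivative (one_sub_X_sq_mul_derivative_gegenbauerPoly_succ μ n)
  have hderiv := X_mul_derivative_gegenbauerPoly_succ μ n
  simp only [derivative_mul, derivative_sub, derivative_one, derivative_X_pow, derivative_C,
    derivative_X] at hladder
  simp only [map_add, map_mul, map_one, map_natCast, map_ofNat, Nat.cast_ofNat]
    at hladder hderiv ⊢
  linear_combination hladder - (n + 2 * C μ) * hderiv

theorem gegenbauerPoly_zero (μ : ℝ) : gegenbauerPoly μ 0 = 1 := by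
  simp [gegenbauerPoly, gegenbauerCoeff, pochhammer_zero]

theorem eval_one_gegenbauerPoly_succ (μ : ℝ) (n : ℕ) :
    (n + 1) * (gegenbauerPoly μ (n + 1)).eval 1 = (n + 2 * μ) * (gegenbauerPoly μ n).eval 1 := by
  have h := congrArg (eval 1) (one_sub_X_sq_mul_derivative_gegenbauerPoly_succ μ n)
  simp only [eval_mul, eval_sub, eval_one, eval_pow, eval_X, eval_C] at h
  linarith

theorem eval_one_gegenbauerPoly_pos {μ : ℝ} (hμ : 0 < μ) (n : ℕ) :
    0 < (gegenbauerPoly μ n).eval 1 := by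
  induction n with
  | zero => simp [gegenbauerPoly_zero]
  | succ n ih =>
    have h : 0 < (n + 1 : ℝ) * (gegenbauerPoly μ (n + 1)).eval 1 := by
      rw [eval_one_gegenbauerPoly_succ]; positivity
    exact pos_of_mul_pos_right h (by positivity)

/-- The quotient `C_n^μ / C_n^μ(1)`, `μ = (d - 2) / 2`, as a polynomial, with the limit `T_n` for
`d = 2`. -/
noncomputable def zonalPoly (d n : ℕ) : ℝ[X] :=
  if d = 2 then Chebyshev.T ℝ n
  else C ((gegenbauerPoly (((d : ℝ) - 2) / 2) n).eval 1)⁻¹ * gegenbauerPoly (((d : ℝ) - 2) / 2) n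

theorem half_dim_sub_two_pos {d : ℕ} (hd : 2 ≤ d) (h : d ≠ 2) : 0 < ((d : ℝ) - 2) / 2 := by
  have : (2 : ℝ) < d := by exact_mod_cast lt_of_le_of_ne hd h.symm
  linarith

theorem eval_zonalPoly {d : ℕ} (hd : 2 ≤ d) (n : ℕ) (t : ℝ) :
    (zonalPoly d n).eval t = gegenbauerQuotient d n t := by
  unfold zonalPoly gegenbauerQuotient
  split_ifs with h
  · rfl
  · have hμ := half_dim_sub_two_pos hd h
    rw [eval_mul, eval_C, eval_gegenbauerPoly hμ, eval_gegenbauerPoly hμ, inv_mul_eq_div]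

theorem zonalPoly_zero (d : ℕ) : zonalPoly d 0 = 1 := by
  unfold zonalPoly
  split_ifs <;> simp [gegenbauerPoly_zero]

theorem one_sub_X_sq_mul_derivative_zonalPoly {d : ℕ} (hd : 2 ≤ d) (n : ℕ) :
    (1 - X ^ 2) * derivative (zonalPoly d n) =
      C (n : ℝ) * (zonalPoly d (n - 1) - X * zonalPoly d n) := by
  cases n with
  | zero => simp [zonalPoly_zero]
  | succ n =>
    unfold zonalPoly
    split_ifs with h
    · have := Chebyshev.one_sub_X_sq_mul_derivative_T_eq_poly_in_T (R := ℝ) n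
      simpa using this
    · have hμ := half_dim_sub_two_pos hd h
      generalize ((d : ℝ) - 2) / 2 = μ at *
      have hladder := one_sub_X_sq_mul_derivative_gegenbauerPoly_succ μ n
      have hpos := eval_one_gegenbauerPoly_pos hμ n
      have hpos' := eval_one_gegenbauerPoly_pos hμ (n + 1)
      have hratio : (n + 2 * μ) * ((gegenbauerPoly μ (n + 1)).eval 1)⁻¹ =
          (n + 1) * ((gegenbauerPoly μ n).eval 1)⁻¹ := by
        field_simp
        linarith [eval_one_gegenbauerPoly_succ μ n]
      have hratio := congrArg C hratio
      rw [map_mul, map_mul] at hratio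
      rw [derivative_C_mul, Nat.add_sub_cancel]
      push_cast
      linear_combination C (eval 1 (gegenbauerPoly μ (n + 1)))⁻¹ * hladder +
        gegenbauerPoly μ n * hratio

theorem zonalPoly_differential_equation (d n : ℕ) :
    (1 - X ^ 2) * derivative (derivative (zonalPoly d n))
      - C (d - 1 : ℝ) * X * derivative (zonalPoly d n)
      + C (n * (n + d - 2) : ℝ) * zonalPoly d n = 0 := by
  unfold zonalPoly
  split_ifs with h
  · have := Chebyshev.one_sub_X_sq_mul_derivative_derivative_T_eq_poly_in_T (R := ℝ) n
    simp only [Function.iterate_succ, Function.iterate_zero, Function.comp, id] at this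
    rw [this, h]
    have hC : (C ((2 : ℕ) - 1 : ℝ) : ℝ[X]) = 1 := by norm_num
    rw [hC]
    simp only [Int.cast_natCast, one_mul, sub_sub_cancel_left, Nat.cast_ofNat,
      add_sub_cancel_right, map_mul, map_natCast]
    ring
  · cases n with
    | zero => simp [gegenbauerPoly_zero]
    | succ n =>
      have hode := gegenbauerPoly_succ_differential_equation (((d : ℝ) - 2) / 2) n
      rw [show 2 * (((d : ℝ) - 2) / 2) + 1 = d - 1 by ring,
        show (n + 1 + 2 * (((d : ℝ) - 2) / 2)) = n + 1 + d - 2 by ring] at hode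
      rw [derivative_C_mul, derivative_C_mul]
      push_cast
      linear_combination C (eval 1 (gegenbauerPoly (((d : ℝ) - 2) / 2) (n + 1)))⁻¹ * hode

end Gegenbauer

section ZonalMeasure

open Polynomial MeasureTheory

theorem integral_rpow_mul_one_sub_rpow {u v : ℝ} (hu : 0 < u) (hv : 0 < v) :
    ∫ x in (0 : ℝ)..1, x ^ (u - 1) * (1 - x) ^ (v - 1) = ProbabilityTheory.beta u v := by
  rw [ProbabilityTheory.beta_eq_betaIntegralReal u v hu hv, Complex.betaIntegral,
    ← Complex.ofReal_re (∫ x in (0 : ℝ)..1, x ^ (u - 1) * (1 - x) ^ (v - 1)),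
    ← intervalIntegral.integral_ofReal]
  congr 1
  refine intervalIntegral.integral_congr fun x hx => ?_
  rw [Set.uIcc_of_le zero_le_one] at hx
  push_cast [Complex.ofReal_cpow hx.1, Complex.ofReal_cpow (sub_nonneg.2 hx.2)]
  rfl

theorem integral_one_sub_sq_rpow {v : ℝ} (hv : 0 < v) :
    ∫ t in (-1 : ℝ)..1, (1 - t ^ 2) ^ (v - 1) =
      √Real.pi * Real.Gamma v / Real.Gamma (v + 1 / 2) := by
  have hsubst : ∫ t in (-1 : ℝ)..1, (1 - t ^ 2) ^ (v - 1) =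
      4 ^ (v - 1) * (2 * ProbabilityTheory.beta v v) := by
    have hfactor : ∀ t ∈ Set.uIcc (-1 : ℝ) 1, (1 - t ^ 2) ^ (v - 1) =
        4 ^ (v - 1) * ((t / 2 + 1 / 2) ^ (v - 1) * (1 - (t / 2 + 1 / 2)) ^ (v - 1)) := by
      intro t ht
      rw [Set.uIcc_of_le (by norm_num)] at ht
      have h1 : 0 ≤ t / 2 + 1 / 2 := by linarith [ht.1]
      have h2 : 0 ≤ 1 - (t / 2 + 1 / 2) := by linarith [ht.2]
      rw [← Real.mul_rpow h1 h2, ← Real.mul_rpow (by norm_num) (mul_nonneg h1 h2)]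
      ring_nf
    rw [intervalIntegral.integral_congr hfactor, intervalIntegral.integral_const_mul,
      intervalIntegral.integral_comp_div_add
        (fun x : ℝ => x ^ (v - 1) * (1 - x) ^ (v - 1)) two_ne_zero (1 / 2),
      ← integral_rpow_mul_one_sub_rpow hv hv]
    norm_num
  have hpow : (4 : ℝ) ^ (v - 1) * 2 * 2 ^ (1 - 2 * v) = 1 := by
    rw [show (4 : ℝ) = 2 ^ (2 : ℝ) by norm_num, ← Real.rpow_mul (by norm_num),
      ← Real.rpow_add_one (by norm_num), ← Real.rpow_add (by norm_num),
      show 2 * (v - 1) + 1 + (1 - 2 * v) = 0 by ring, Real.rpow_zero]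
  have hduplication := Real.Gamma_mul_Gamma_add_half v
  have := Real.Gamma_pos_of_pos hv
  have hΓ_half := Real.Gamma_pos_of_pos (by linarith : 0 < v + 1 / 2)
  have hΓ_two := Real.Gamma_pos_of_pos (by linarith : 0 < 2 * v)
  rw [hsubst, ProbabilityTheory.beta, ← two_mul, mul_div_assoc', mul_div_assoc',
    div_eq_div_iff hΓ_two.ne' hΓ_half.ne']
  linear_combination (4 ^ (v - 1) * 2 * Real.Gamma v : ℝ) * hduplication +
    Real.Gamma v * Real.Gamma (2 * v) * √Real.pi * hpow

theorem integral_weight {d : ℕ} (hd : 2 ≤ d) :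
    ∫ t in Set.Ioo (-1 : ℝ) 1, weight d t =
      √Real.pi * Real.Gamma ((d - 1) / 2) / Real.Gamma (d / 2) := by
  have hd : (2 : ℝ) ≤ d := by exact_mod_cast hd
  have h := integral_one_sub_sq_rpow (v := ((d : ℝ) - 1) / 2) (by linarith)
  rw [intervalIntegral.integral_of_le (by norm_num), integral_Ioc_eq_integral_Ioo,
    show ((d : ℝ) - 1) / 2 + 1 / 2 = d / 2 by ring,
    show ((d : ℝ) - 1) / 2 - 1 = (d - 3) / 2 by ring] at h
  exact h

theorem integrableOn_weight {d : ℕ} (hd : 2 ≤ d) :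
    IntegrableOn (weight d) (Set.Ioo (-1 : ℝ) 1) := by
  refine Integrable.of_integral_ne_zero ?_
  have hd' : (2 : ℝ) ≤ d := by exact_mod_cast hd
  have := Real.Gamma_pos_of_pos (by linarith : 0 < ((d : ℝ) - 1) / 2)
  have := Real.Gamma_pos_of_pos (by linarith : 0 < (d : ℝ) / 2)
  rw [integral_weight hd]
  positivity

theorem surfaceArea_zero : surfaceArea 0 = 0 := by
  simp [surfaceArea, surfaceMeasure]

theorem surfaceArea_eq {d : ℕ} (hd : 1 ≤ d) :
    surfaceArea d = 2 * √Real.pi ^ d / Real.Gamma (d / 2) := by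
  have : Nonempty (Fin d) := ⟨⟨0, hd⟩⟩
  have : (0 : ℝ) < d := by exact_mod_cast hd
  have : 0 < Real.Gamma ((d : ℝ) / 2) := Real.Gamma_pos_of_pos (by positivity)
  rw [surfaceArea, surfaceMeasure, Measure.toSphere_real_apply_univ, Measure.real,
    EuclideanSpace.volume_ball, finrank_euclideanSpace, Fintype.card_fin,
    Real.Gamma_add_one (by positivity), ENNReal.toReal_mul, ENNReal.toReal_ofReal (by positivity)]
  simp only [ENNReal.ofReal_one, one_pow, ENNReal.toReal_one, one_mul]
  field_simp

theorem surfaceArea_nonneg (d : ℕ) : 0 ≤ surfaceArea d :=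
  measureReal_nonneg

theorem surfaceArea_mul_integral_weight {d : ℕ} (hd : 2 ≤ d) :
    surfaceArea (d - 1) * ∫ t in Set.Ioo (-1 : ℝ) 1, weight d t = surfaceArea d := by
  have hd' : (2 : ℝ) ≤ d := by exact_mod_cast hd
  have := Real.Gamma_pos_of_pos (by linarith : 0 < ((d : ℝ) - 1) / 2)
  have := Real.Gamma_pos_of_pos (by linarith : 0 < (d : ℝ) / 2)
  rw [integral_weight hd, surfaceArea_eq (by omega), surfaceArea_eq (by omega),
    Nat.cast_pred (by omega)]
  conv_rhs => rw [← Nat.sub_add_cancel (by omega : 1 ≤ d), pow_succ, Nat.sub_add_cancel (by omega)]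
  field_simp

theorem weight_nonneg (d : ℕ) {t : ℝ} (ht : t ∈ Set.Ioo (-1 : ℝ) 1) : 0 ≤ weight d t :=
  Real.rpow_nonneg (by nlinarith [ht.1, ht.2]) _

theorem measurable_weight (d : ℕ) : Measurable (weight d) := by
  unfold weight
  fun_prop

/-- The measure `ω_{d-1} (1 - t²)^{(d-3)/2} dt` on `(-1, 1)`, which turns out to be the
distribution of `⟨x, y⟩` when `y` has the distribution `σ`. -/
noncomputable def zonalMeasure (d : ℕ) : Measure ℝ :=
  (volume.restrict (Set.Ioo (-1 : ℝ) 1)).withDensity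
    fun t => ENNReal.ofReal (surfaceArea (d - 1) * weight d t)

instance isFiniteMeasure_zonalMeasure (d : ℕ) : IsFiniteMeasure (zonalMeasure d) := by
  refine isFiniteMeasure_withDensity_ofReal ?_
  obtain hd | hd := lt_or_ge d 2
  · simp [show d - 1 = 0 by omega, surfaceArea_zero]
  · exact ((integrableOn_weight hd).const_mul _).2

theorem ae_zonalMeasure_mem_Icc (d : ℕ) : ∀ᵐ t ∂zonalMeasure d, t ∈ Set.Icc (-1 : ℝ) 1 :=
  (withDensity_absolutelyContinuous _ _).ae_le
    ((ae_restrict_mem measurableSet_Ioo).mono fun _ ht => Set.Ioo_subset_Icc_self ht)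

theorem measurable_zonalDensity (d : ℕ) :
    Measurable fun t => ENNReal.ofReal (surfaceArea (d - 1) * weight d t) :=
  ((measurable_weight d).const_mul _).ennreal_ofReal

theorem toReal_zonalDensity_smul (d : ℕ) (f : ℝ → ℝ) {t : ℝ} (ht : t ∈ Set.Ioo (-1 : ℝ) 1) :
    (ENNReal.ofReal (surfaceArea (d - 1) * weight d t)).toReal • f t =
      surfaceArea (d - 1) * (f t * weight d t) := by
  rw [ENNReal.toReal_ofReal (mul_nonneg (surfaceArea_nonneg _) (weight_nonneg d ht)), smul_eq_mul]
  ring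

theorem integral_zonalMeasure (d : ℕ) (f : ℝ → ℝ) :
    ∫ t, f t ∂zonalMeasure d =
      surfaceArea (d - 1) * ∫ t in Set.Ioo (-1 : ℝ) 1, f t * weight d t := by
  rw [zonalMeasure, integral_withDensity_eq_integral_toReal_smul (measurable_zonalDensity d)
    (.of_forall fun _ => ENNReal.ofReal_lt_top), ← integral_const_mul]
  exact setIntegral_congr_fun measurableSet_Ioo fun t ht => toReal_zonalDensity_smul d f ht

theorem integrable_zonalMeasure_of_integrableOn {d : ℕ} {f : ℝ → ℝ}
    (hf : IntegrableOn (fun t => f t * weight d t) (Set.Ioo (-1 : ℝ) 1)) :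
    Integrable f (zonalMeasure d) := by
  rw [zonalMeasure, integrable_withDensity_iff_integrable_smul' (measurable_zonalDensity d)
    (.of_forall fun _ => ENNReal.ofReal_lt_top)]
  refine (hf.const_mul (surfaceArea (d - 1))).congr ?_
  filter_upwards [ae_restrict_mem measurableSet_Ioo] with t ht
  exact (toReal_zonalDensity_smul d f ht).symm

theorem integrable_eval_of_ae_mem_Icc {ρ : Measure ℝ} [IsFiniteMeasure ρ] {a b : ℝ}
    (hρ : ∀ᵐ t ∂ρ, t ∈ Set.Icc a b) (p : ℝ[X]) : Integrable (fun t => p.eval t) ρ := by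
  obtain ⟨M, hM⟩ := isCompact_Icc.exists_bound_of_continuousOn (p.continuousOn (s := Set.Icc a b))
  exact .of_bound p.continuous.aestronglyMeasurable M (hρ.mono hM)

/-- Integration against `zonalMeasure d` as a linear functional on polynomials. -/
noncomputable def zonalIntegral (d : ℕ) : ℝ[X] →ₗ[ℝ] ℝ where
  toFun p := ∫ t, p.eval t ∂zonalMeasure d
  map_add' p q := by
    simp only [eval_add]
    exact integral_add (integrable_eval_of_ae_mem_Icc (ae_zonalMeasure_mem_Icc d) p)
      (integrable_eval_of_ae_mem_Icc (ae_zonalMeasure_mem_Icc d) q)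
  map_smul' a p := by
    simp only [eval_smul]
    exact integral_smul a _

theorem zonalIntegral_apply (d : ℕ) (p : ℝ[X]) :
    zonalIntegral d p = ∫ t, p.eval t ∂zonalMeasure d :=
  rfl

theorem zonalIntegral_one {d : ℕ} (hd : 2 ≤ d) : zonalIntegral d 1 = surfaceArea d := by
  simp only [zonalIntegral_apply, eval_one, integral_zonalMeasure, one_mul,
    surfaceArea_mul_integral_weight hd]

theorem hasDerivAt_eval_mul_one_sub_sq_rpow (d : ℕ) (q : ℝ[X]) {t : ℝ}
    (ht : t ∈ Set.Ioo (-1 : ℝ) 1) :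
    HasDerivAt (fun t => q.eval t * (1 - t ^ 2) ^ (((d : ℝ) - 1) / 2))
      (((1 - X ^ 2) * derivative q - (d - 1 : ℝ) • (X * q)).eval t * weight d t) t := by
  have hpos : 0 < 1 - t ^ 2 := by nlinarith [ht.1, ht.2]
  have hsq : HasDerivAt (fun t : ℝ => 1 - t ^ 2) (-(2 * t)) t := by
    simpa using (hasDerivAt_pow 2 t).const_sub 1
  refine ((q.hasDerivAt t).mul (hsq.rpow_const (p := ((d : ℝ) - 1) / 2)
    (.inl hpos.ne'))).congr_deriv ?_
  rw [show ((d : ℝ) - 1) / 2 - 1 = (d - 3) / 2 by ring,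
    show ((d : ℝ) - 1) / 2 = (d - 3) / 2 + 1 by ring, Real.rpow_add_one hpos.ne', weight]
  simp only [eval_sub, eval_mul, eval_one, eval_pow, eval_X, eval_smul, smul_eq_mul]
  ring

theorem integrableOn_eval_mul_weight {d : ℕ} (hd : 2 ≤ d) (q : ℝ[X]) :
    IntegrableOn (fun t => q.eval t * weight d t) (Set.Ioo (-1 : ℝ) 1) :=
  IntegrableOn.continuousOn_mul_of_subset q.continuousOn (integrableOn_weight hd)
    isCompact_Icc measurableSet_Ioo Set.Ioo_subset_Icc_self

theorem zonalIntegral_one_sub_X_sq_mul_derivative {d : ℕ} (hd : 2 ≤ d) (q : ℝ[X]) :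
    zonalIntegral d ((1 - X ^ 2) * derivative q) = (d - 1) * zonalIntegral d (X * q) := by
  have hd' : (2 : ℝ) ≤ d := by exact_mod_cast hd
  have hexp : 0 < ((d : ℝ) - 1) / 2 := by linarith
  rw [← smul_eq_mul (a := (d - 1 : ℝ)), ← map_smul, ← sub_eq_zero, ← map_sub, zonalIntegral_apply,
    integral_zonalMeasure, ← integral_Ioc_eq_integral_Ioo,
    ← intervalIntegral.integral_of_le (by norm_num),
    intervalIntegral.integral_eq_sub_of_hasDerivAt_of_le (by norm_num)
      (q.continuousOn.mul (.rpow_const (by fun_prop) fun _ _ => .inr hexp.le))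
      (fun t ht => hasDerivAt_eval_mul_one_sub_sq_rpow d q ht)
      ((intervalIntegrable_iff_integrableOn_Ioo_of_le (by norm_num)).2
        (integrableOn_eval_mul_weight hd _))]
  norm_num [Real.zero_rpow hexp.ne']

theorem zonalIntegral_zonalPoly_eq_zero {d n : ℕ} (hd : 2 ≤ d) (hn : n ≠ 0) :
    zonalIntegral d (zonalPoly d n) = 0 := by
  have hdiv := zonalIntegral_one_sub_X_sq_mul_derivative hd (derivative (zonalPoly d n))
  have heigen : (n * (n + d - 2) : ℝ) • zonalPoly d n =
      (d - 1 : ℝ) • (X * derivative (zonalPoly d n))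
        - (1 - X ^ 2) * derivative (derivative (zonalPoly d n)) := by
    rw [smul_eq_C_mul, smul_eq_C_mul]
    linear_combination zonalPoly_differential_equation d n
  have hzero := congrArg (zonalIntegral d) heigen
  rw [map_sub, map_smul, map_smul, hdiv, smul_eq_mul, smul_eq_mul, sub_self] at hzero
  have hn' : (1 : ℝ) ≤ n := by exact_mod_cast Nat.one_le_iff_ne_zero.2 hn
  have hd' : (2 : ℝ) ≤ d := by exact_mod_cast hd
  exact (mul_eq_zero.1 hzero).resolve_left (mul_pos (by linarith) (by linarith)).ne'

/-- The moment `ω_{d-1} ∫_{-1}^1 t^k P_n(t) (1 - t²)^{(d-3)/2} dt`, where `P_n` is the polynomial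
`zonalPoly d n`. -/
noncomputable def zonalMoment (d n k : ℕ) : ℝ :=
  zonalIntegral d (X ^ k * zonalPoly d n)

theorem zonalMoment_zero_right {d n : ℕ} (hd : 2 ≤ d) (hn : n ≠ 0) : zonalMoment d n 0 = 0 := by
  rw [zonalMoment, pow_zero, one_mul, zonalIntegral_zonalPoly_eq_zero hd hn]

theorem zonalMoment_zero_zero {d : ℕ} (hd : 2 ≤ d) : zonalMoment d 0 0 = surfaceArea d := by
  rw [zonalMoment, pow_zero, one_mul, zonalPoly_zero, zonalIntegral_one hd]

theorem zonalMoment_succ {d : ℕ} (hd : 2 ≤ d) (n k : ℕ) :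
    (k + n + d - 1) * zonalMoment d n (k + 1) =
      k * zonalMoment d n (k - 1) + n * zonalMoment d (n - 1) k := by
  have hdiv := zonalIntegral_one_sub_X_sq_mul_derivative hd (X ^ k * zonalPoly d n)
  have hpow : (k : ℝ[X]) * X ^ (k - 1) * X ^ 2 = (k : ℝ[X]) * X ^ (k + 1) := by
    cases k with
    | zero => simp
    | succ k => rw [Nat.add_sub_cancel]; ring
  have hderiv : (1 - X ^ 2) * derivative (X ^ k * zonalPoly d n) =
      (k : ℝ) • (X ^ (k - 1) * zonalPoly d n) + (n : ℝ) • (X ^ k * zonalPoly d (n - 1))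
        - (k + n : ℝ) • (X ^ (k + 1) * zonalPoly d n) := by
    have hladder := one_sub_X_sq_mul_derivative_zonalPoly hd n
    rw [derivative_mul, derivative_X_pow]
    simp only [smul_eq_C_mul, map_add, map_natCast] at hladder ⊢
    linear_combination X ^ k * hladder - zonalPoly d n * hpow
  rw [hderiv, map_sub, map_add, map_smul, map_smul, map_smul, ← mul_assoc, ← pow_succ'] at hdiv
  simp only [smul_eq_mul] at hdiv
  simp only [zonalMoment]
  linear_combination -hdiv

end ZonalMeasure

section DirectionalDerivative

open MvPolynomial

variable {R σ : Type*} [CommRing R]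

theorem pderiv_comm (i j : σ) (q : MvPolynomial σ R) :
    pderiv i (pderiv j q) = pderiv j (pderiv i q) := by
  classical
  have hcommutator : ⁅(pderiv i : Derivation R (MvPolynomial σ R) (MvPolynomial σ R)),
      (pderiv j : Derivation R (MvPolynomial σ R) (MvPolynomial σ R))⁆ = 0 :=
    derivation_ext fun k => by
      simp [Derivation.commutator_apply, pderiv_X, Pi.single_apply, apply_ite]
  have h := DFunLike.congr_fun hcommutator q
  rwa [Derivation.commutator_apply, Derivation.zero_apply, sub_eq_zero] at h

theorem eval_mul_of_isHomogeneous {m : ℕ} {q : MvPolynomial σ R} (hq : q.IsHomogeneous m)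
    (r : R) (v : σ → R) : eval (fun i => r * v i) q = r ^ m * eval v q := by
  rw [eval_eq, eval_eq, Finset.mul_sum]
  refine Finset.sum_congr rfl fun s hs => ?_
  have hdegree : ∑ i ∈ s.support, s i = m := by
    rw [← Finsupp.degree_apply, Finsupp.degree_eq_weight_one]
    exact hq (mem_support_iff.1 hs)
  simp only [mul_pow, Finset.prod_mul_distrib, Finset.prod_pow_eq_pow_sum, hdegree]
  ring

variable [Fintype σ]

/-- The linear form `⟨x, ·⟩` as a polynomial. -/
noncomputable def linearForm (x : σ → R) : MvPolynomial σ R :=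
  ∑ i, C (x i) * X i

/-- The derivative `∂_x = ∑ xᵢ ∂ᵢ` in the direction `x`, as a derivation. -/
noncomputable def dirDeriv (x : σ → R) : Derivation R (MvPolynomial σ R) (MvPolynomial σ R) :=
  ∑ i, (C (x i) : MvPolynomial σ R) • pderiv i

theorem isHomogeneous_linearForm_pow (x : σ → R) (k : ℕ) : (linearForm x ^ k).IsHomogeneous k := by
  have h : (linearForm x).IsHomogeneous 1 :=
    .sum _ _ _ fun i _ => isHomogeneous_C_mul_X (x i) i
  simpa using h.pow k

theorem dirDeriv_apply (x : σ → R) (q : MvPolynomial σ R) :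
    dirDeriv x q = ∑ i, C (x i) * pderiv i q := by
  rw [dirDeriv, ← Derivation.coeFnAddMonoidHom_apply, map_sum, Finset.sum_apply]
  rfl

theorem dirDeriv_linearForm (x y : σ → R) : dirDeriv x (linearForm y) = C (∑ i, x i * y i) := by
  classical
  simp [linearForm, dirDeriv_apply, pderiv_X, Pi.single_apply, mul_comm]

theorem eval_dirDeriv_self {n : ℕ} (x : σ → R) {q : MvPolynomial σ R} (hq : q.IsHomogeneous n) :
    eval x (dirDeriv x q) = n * eval x q := by
  have heuler := congrArg (eval x) hq.sum_X_mul_pderiv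
  simpa [dirDeriv_apply] using heuler

theorem pderiv_dirDeriv (x : σ → R) (i : σ) (q : MvPolynomial σ R) :
    pderiv i (dirDeriv x q) = dirDeriv x (pderiv i q) := by
  simp only [dirDeriv_apply, map_sum, pderiv_C_mul, pderiv_comm i]

end DirectionalDerivative

section HarmonicSpace

open MvPolynomial

variable {d n : ℕ} {Y : MvPolynomial (Fin d) ℝ}

theorem polyLaplacian_apply (q : MvPolynomial (Fin d) ℝ) :
    polyLaplacian d q = ∑ i, pderiv i (pderiv i q) := by
  simp [polyLaplacian]

theorem mem_harmonicSpace :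
    Y ∈ harmonicSpace d n ↔ Y.IsHomogeneous n ∧ ∑ i, pderiv i (pderiv i Y) = 0 := by
  rw [← polyLaplacian_apply]
  rfl

theorem one_mem_harmonicSpace_zero (d : ℕ) : 1 ∈ harmonicSpace d 0 := by
  simp [mem_harmonicSpace, isHomogeneous_one]

theorem dirDeriv_mem_harmonicSpace (x : Fin d → ℝ) (hY : Y ∈ harmonicSpace d n) :
    dirDeriv x Y ∈ harmonicSpace d (n - 1) := by
  rw [mem_harmonicSpace] at hY ⊢
  constructor
  · rw [dirDeriv_apply]
    exact IsHomogeneous.sum _ _ _ fun i _ => hY.1.pderiv.C_mul (x i)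
  · simp only [pderiv_dirDeriv, ← map_sum, hY.2, map_zero]

end HarmonicSpace

section GaussianIntegral

open MvPolynomial MeasureTheory

variable {ι : Type*}

theorem hasLineDerivAt_eval [DecidableEq ι] (i : ι) (q : MvPolynomial ι ℝ)
    (y : EuclideanSpace ℝ ι) :
    HasLineDerivAt ℝ (fun y : EuclideanSpace ℝ ι => eval y q) (eval y (pderiv i q)) y
      (EuclideanSpace.single i 1) := by
  unfold HasLineDerivAt
  induction q using MvPolynomial.induction_on with
  | C a => simpa using hasDerivAt_const (0 : ℝ) a
  | add p q hp hq =>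
    simp only [map_add]
    exact hp.add hq
  | mul_X p j hp =>
    have hX : HasDerivAt (fun t : ℝ => (y + t • EuclideanSpace.single i (1 : ℝ)) j)
        (EuclideanSpace.single i (1 : ℝ) j) 0 := by
      simpa using ((hasDerivAt_id (0 : ℝ)).mul_const
        (EuclideanSpace.single i (1 : ℝ) j)).const_add (y j)
    simp only [eval_mul, eval_X]
    refine (hp.mul hX).congr_deriv ?_
    obtain rfl | hij := eq_or_ne j i
    · simp [add_comm, mul_comm]
    · simp [pderiv_X_of_ne hij, hij, mul_comm]

variable [Fintype ι]

theorem abs_mul_exp_neg_mul_sq_le {b r s : ℝ} (hb : 0 < b) (hs : |s| ≤ r) :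
    |s * Real.exp (-b * r ^ 2)| ≤ 1 + 1 / b := by
  have hr : r ≤ 1 + r ^ 2 := by nlinarith [sq_nonneg (r - 1)]
  have hb' : 0 < 1 / b := by positivity
  rw [abs_mul, Real.abs_exp, neg_mul, Real.exp_neg, ← div_eq_mul_inv,
    div_le_iff₀ (Real.exp_pos _)]
  calc |s| ≤ 1 + r ^ 2 := hs.trans hr
    _ ≤ b * r ^ 2 + 1 + r ^ 2 + 1 / b := by nlinarith [mul_nonneg hb.le (sq_nonneg r)]
    _ = (1 + 1 / b) * (b * r ^ 2 + 1) := by field_simp; ring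
    _ ≤ (1 + 1 / b) * Real.exp (b * r ^ 2) := by gcongr; exact Real.add_one_le_exp _

theorem integrable_exp_neg_mul_sq_norm {V : Type*} [NormedAddCommGroup V] [InnerProductSpace ℝ V]
    [FiniteDimensional ℝ V] [MeasurableSpace V] [BorelSpace V] {b : ℝ} (hb : 0 < b) :
    Integrable fun y : V => Real.exp (-b * ‖y‖ ^ 2) := by
  have h := GaussianFourier.integrable_cexp_neg_mul_sq_norm_add (V := V) (b := b) (by simpa) 0 0
  refine h.re.congr (.of_forall fun y => ?_)
  simp [Complex.exp_re, ← Complex.ofReal_pow]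

theorem integrable_eval_mul_exp_neg_mul_sq_norm (q : MvPolynomial ι ℝ) {b : ℝ} (hb : 0 < b) :
    Integrable fun y : EuclideanSpace ℝ ι => eval y q * Real.exp (-b * ‖y‖ ^ 2) := by
  induction q using MvPolynomial.induction_on generalizing b with
  | C a => simpa using (integrable_exp_neg_mul_sq_norm hb).const_mul a
  | add p q hp hq =>
    simp only [map_add, add_mul]
    exact (hp hb).add (hq hb)
  | mul_X p j hp =>
    have hbdd := (hp (half_pos hb)).bdd_mul (c := 1 + 1 / (b / 2))
      (f := fun y : EuclideanSpace ℝ ι => y j * Real.exp (-(b / 2) * ‖y‖ ^ 2))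
      (Continuous.aestronglyMeasurable (by fun_prop))
      (.of_forall fun y => abs_mul_exp_neg_mul_sq_le (half_pos hb) (PiLp.norm_apply_le y j))
    refine hbdd.congr (.of_forall fun y => ?_)
    have hexp : Real.exp (-b * ‖y‖ ^ 2) =
        Real.exp (-(b / 2) * ‖y‖ ^ 2) * Real.exp (-(b / 2) * ‖y‖ ^ 2) := by
      rw [← Real.exp_add]
      ring_nf
    simp only [eval_mul, eval_X, hexp]
    ring

theorem hasLineDerivAt_exp_neg_mul_sq_norm [DecidableEq ι] (b : ℝ) (i : ι)
    (y : EuclideanSpace ℝ ι) :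
    HasLineDerivAt ℝ (fun y : EuclideanSpace ℝ ι => Real.exp (-b * ‖y‖ ^ 2))
      (-(2 * b) * (y i * Real.exp (-b * ‖y‖ ^ 2))) y (EuclideanSpace.single i 1) := by
  have h := (((hasStrictFDerivAt_norm_sq y).hasFDerivAt.const_mul (-b)).exp).hasLineDerivAt
    (EuclideanSpace.single i (1 : ℝ))
  have heval : (Real.exp (-b * ‖y‖ ^ 2) • (-b) • 2 • innerSL ℝ y) (EuclideanSpace.single i 1) =
      -(2 * b) * (y i * Real.exp (-b * ‖y‖ ^ 2)) := by
    simp only [neg_mul, neg_smul, smul_neg, neg_apply, smul_apply, coe_innerSL_apply,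
      EuclideanSpace.inner_single_right, Real.ringHom_apply, one_mul, nsmul_eq_mul,
      Nat.cast_ofNat, smul_eq_mul, neg_inj]
    ring
  rwa [heval] at h

theorem two_mul_integral_eval_X_mul_mul_exp_neg_mul_sq_norm {b : ℝ} (hb : 0 < b) (i : ι)
    (q : MvPolynomial ι ℝ) :
    2 * b * ∫ y : EuclideanSpace ℝ ι, eval y (X i * q) * Real.exp (-b * ‖y‖ ^ 2) =
      ∫ y : EuclideanSpace ℝ ι, eval y (pderiv i q) * Real.exp (-b * ‖y‖ ^ 2) := by
  classical
  have hX : ∀ y : EuclideanSpace ℝ ι,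
      eval y q * (-(2 * b) * (y i * Real.exp (-b * ‖y‖ ^ 2))) =
        -(2 * b) * (eval y (X i * q) * Real.exp (-b * ‖y‖ ^ 2)) := fun y => by
    rw [eval_mul, eval_X]
    ring
  have hparts := integral_bilinear_hasLineDerivAt_right_eq_neg_left_of_integrable
    (μ := (volume : Measure (EuclideanSpace ℝ ι))) (B := ContinuousLinearMap.mul ℝ ℝ)
    (integrable_eval_mul_exp_neg_mul_sq_norm (pderiv i q) hb)
    (((integrable_eval_mul_exp_neg_mul_sq_norm (X i * q) hb).const_mul (-(2 * b))).congr
      (.of_forall fun y => (hX y).symm))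
    (integrable_eval_mul_exp_neg_mul_sq_norm q hb)
    (fun y _ => hasLineDerivAt_eval i q y)
    (fun y _ => hasLineDerivAt_exp_neg_mul_sq_norm b i y)
  simp only [ContinuousLinearMap.mul_apply', hX, integral_const_mul] at hparts
  linarith

end GaussianIntegral

section PolarCoordinates

open MeasureTheory Set

theorem integral_mul_comp_norm_of_homogeneous {E : Type*} [NormedAddCommGroup E] [NormedSpace ℝ E]
    [FiniteDimensional ℝ E] [Nontrivial E] [MeasurableSpace E] [BorelSpace E] (μ : Measure E)
    [μ.IsAddHaarMeasure] {m : ℕ} {F : E → ℝ} (hF : ∀ r > 0, ∀ y, F (r • y) = r ^ m * F y)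
    (h : ℝ → ℝ) :
    ∫ y, F y * h ‖y‖ ∂μ = (∫ y : Metric.sphere (0 : E) 1, F y ∂μ.toSphere) *
      ∫ r in Ioi (0 : ℝ), r ^ (Module.finrank ℝ E - 1 + m) * h r := by
  have hradial : ∫ r : Ioi (0 : ℝ), r.1 ^ m * h r ∂Measure.volumeIoiPow (Module.finrank ℝ E - 1) =
      ∫ r in Ioi (0 : ℝ), r ^ (Module.finrank ℝ E - 1 + m) * h r := by
    simp only [Measure.volumeIoiPow]
    rw [integral_withDensity_eq_integral_toReal_smul (by fun_prop)
      (.of_forall fun _ => ENNReal.ofReal_lt_top), ← integral_subtype_comap measurableSet_Ioi]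
    congr 1 with r
    rw [ENNReal.toReal_ofReal (pow_nonneg r.2.out.le _), smul_eq_mul, pow_add, mul_assoc]
  have hpunctured := integral_subtype_comap (μ := μ) (measurableSet_singleton (0 : E)).compl
    fun y => F y * h ‖y‖
  rw [restrict_compl_singleton] at hpunctured
  rw [← hpunctured, ← hradial, ← integral_prod_mul,
    ← μ.measurePreserving_homeomorphUnitSphereProd.integral_comp
      (Homeomorph.measurableEmbedding _)]
  refine integral_congr_ae (.of_forall fun y => ?_)
  have hy : 0 < ‖y.1‖ := norm_pos_iff.2 y.2
  simp only [homeomorphUnitSphereProd_apply_fst_coe, homeomorphUnitSphereProd_apply_snd_coe,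
    hF _ (inv_pos.2 hy), inv_pow]
  field_simp

theorem integral_Ioi_pow_mul_exp_neg_mul_sq {b : ℝ} (hb : 0 < b) (k : ℕ) :
    ∫ r in Ioi (0 : ℝ), r ^ k * Real.exp (-b * r ^ 2) =
      b ^ (-((k : ℝ) + 1) / 2) * (1 / 2) * Real.Gamma (((k : ℝ) + 1) / 2) := by
  rw [← integral_rpow_mul_exp_neg_mul_rpow two_pos (by linarith [k.cast_nonneg (α := ℝ)]) hb]
  simp only [Real.rpow_natCast, Real.rpow_two]

theorem integral_Ioi_pow_mul_exp_neg_mul_sq_pos {b : ℝ} (hb : 0 < b) (k : ℕ) :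
    0 < ∫ r in Ioi (0 : ℝ), r ^ k * Real.exp (-b * r ^ 2) := by
  have := Real.Gamma_pos_of_pos (by positivity : 0 < ((k : ℝ) + 1) / 2)
  rw [integral_Ioi_pow_mul_exp_neg_mul_sq hb]
  positivity

theorem two_mul_integral_Ioi_pow_add_two_mul_exp_neg_mul_sq {b : ℝ} (hb : 0 < b) (k : ℕ) :
    2 * b * ∫ r in Ioi (0 : ℝ), r ^ (k + 2) * Real.exp (-b * r ^ 2) =
      (k + 1) * ∫ r in Ioi (0 : ℝ), r ^ k * Real.exp (-b * r ^ 2) := by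
  rw [integral_Ioi_pow_mul_exp_neg_mul_sq hb, integral_Ioi_pow_mul_exp_neg_mul_sq hb]
  push_cast
  rw [show ((k : ℝ) + 2 + 1) / 2 = (k + 1) / 2 + 1 by ring, Real.Gamma_add_one (by positivity),
    show -((k : ℝ) + 2 + 1) / 2 = -(k + 1) / 2 - 1 by ring, Real.rpow_sub_one hb.ne']
  field_simp

end PolarCoordinates

section SphereIntegral

open MvPolynomial MeasureTheory

variable {d : ℕ}

theorem continuous_eval_sphere (q : MvPolynomial (Fin d) ℝ) :
    Continuous fun y : unitSphere d => eval (fun i => y.1 i) q :=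
  (MvPolynomial.continuous_eval q).comp (by fun_prop)

theorem exists_forall_norm_eval_sphere_le (q : MvPolynomial (Fin d) ℝ) :
    ∃ M : ℝ, ∀ y : unitSphere d, ‖eval (fun i => y.1 i) q‖ ≤ M := by
  simpa using isCompact_univ.exists_bound_of_continuousOn (continuous_eval_sphere q).continuousOn

theorem integrable_eval_sphere (q : MvPolynomial (Fin d) ℝ) :
    Integrable (fun y : unitSphere d => eval (fun i => y.1 i) q) (surfaceMeasure d) := by
  obtain ⟨M, hM⟩ := exists_forall_norm_eval_sphere_le q
  exact .of_bound (continuous_eval_sphere q).aestronglyMeasurable M (.of_forall hM)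

/-- Integration over the unit sphere as a linear functional on polynomials. -/
noncomputable def sphereIntegral (d : ℕ) : MvPolynomial (Fin d) ℝ →ₗ[ℝ] ℝ where
  toFun q := ∫ y : unitSphere d, eval (fun i => y.1 i) q ∂surfaceMeasure d
  map_add' p q := by
    simp only [map_add]
    exact integral_add (integrable_eval_sphere p) (integrable_eval_sphere q)
  map_smul' a q := by
    simp only [MvPolynomial.smul_eval]
    exact integral_const_mul a _

theorem sphereIntegral_apply (q : MvPolynomial (Fin d) ℝ) :
    sphereIntegral d q = ∫ y : unitSphere d, eval (fun i => y.1 i) q ∂surfaceMeasure d :=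
  rfl

theorem sphereIntegral_C_mul (a : ℝ) (q : MvPolynomial (Fin d) ℝ) :
    sphereIntegral d (C a * q) = a * sphereIntegral d q := by
  rw [← smul_eq_C_mul, map_smul, smul_eq_mul]

theorem sphereIntegral_one (d : ℕ) : sphereIntegral d 1 = surfaceArea d := by
  simp [sphereIntegral_apply, surfaceArea]

theorem integral_eval_mul_comp_norm [NeZero d] {m : ℕ} {q : MvPolynomial (Fin d) ℝ}
    (hq : q.IsHomogeneous m) (h : ℝ → ℝ) :
    ∫ y : EuclideanSpace ℝ (Fin d), eval y q * h ‖y‖ =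
      sphereIntegral d q * ∫ r in Set.Ioi (0 : ℝ), r ^ (d - 1 + m) * h r := by
  have hhom := integral_mul_comp_norm_of_homogeneous
    (volume : Measure (EuclideanSpace ℝ (Fin d))) (F := fun y => eval y q)
    (fun r _ y => eval_mul_of_isHomogeneous hq r y) h
  rwa [finrank_euclideanSpace_fin] at hhom

theorem sphereIntegral_X_mul {m : ℕ} (i : Fin d) {q : MvPolynomial (Fin d) ℝ}
    (hq : q.IsHomogeneous m) :
    (m + d - 1) * sphereIntegral d (X i * q) = sphereIntegral d (pderiv i q) := by
  have : NeZero d := ⟨i.pos.ne'⟩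
  have hparts := two_mul_integral_eval_X_mul_mul_exp_neg_mul_sq_norm one_pos i q
  rw [integral_eval_mul_comp_norm ((isHomogeneous_X ℝ i).mul hq) fun r => Real.exp (-1 * r ^ 2),
    integral_eval_mul_comp_norm (hq.pderiv (i := i)) fun r => Real.exp (-1 * r ^ 2)] at hparts
  cases m with
  | zero =>
    obtain ⟨c, rfl⟩ : ∃ c, q = C c :=
      ⟨_, totalDegree_eq_zero_iff_eq_C.1 (Nat.le_zero.1 hq.totalDegree_le)⟩
    have hmoment := integral_Ioi_pow_mul_exp_neg_mul_sq_pos one_pos (d - 1 + (1 + 0))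
    rw [pderiv_C, map_zero, zero_mul] at hparts
    have hzero : sphereIntegral d (X i * C c) = 0 :=
      (mul_eq_zero.1 ((mul_eq_zero_iff_left (by norm_num)).1 hparts)).resolve_right hmoment.ne'
    rw [hzero, pderiv_C, map_zero, mul_zero]
  | succ m =>
    have hmoment := integral_Ioi_pow_mul_exp_neg_mul_sq_pos one_pos (d - 1 + m)
    have hrec := two_mul_integral_Ioi_pow_add_two_mul_exp_neg_mul_sq one_pos (d - 1 + m)
    rw [Nat.add_sub_cancel, show d - 1 + (1 + (m + 1)) = d - 1 + m + 2 by omega] at hparts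
    refine mul_right_cancel₀ hmoment.ne' ?_
    push_cast [Nat.cast_pred i.pos] at hrec ⊢
    linear_combination hparts - sphereIntegral d (X i * q) * hrec

end SphereIntegral

section SphereMoments

open MvPolynomial

variable {d n : ℕ} {x : Fin d → ℝ} {Y : MvPolynomial (Fin d) ℝ}

theorem sphereIntegral_linearForm_mul {m : ℕ} (x : Fin d → ℝ) {q : MvPolynomial (Fin d) ℝ}
    (hq : q.IsHomogeneous m) :
    (m + d - 1) * sphereIntegral d (linearForm x * q) = sphereIntegral d (dirDeriv x q) := by
  simp only [linearForm, dirDeriv_apply, Finset.sum_mul, Finset.mul_sum, map_sum, mul_assoc,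
    sphereIntegral_C_mul, ← sphereIntegral_X_mul _ hq]
  exact Finset.sum_congr rfl fun i _ => mul_left_comm _ _ _

theorem sphereIntegral_linearForm_pow_succ_mul (hx : ∑ i, x i ^ 2 = 1) (k : ℕ)
    (hY : Y.IsHomogeneous n) :
    (k + n + d - 1) * sphereIntegral d (linearForm x ^ (k + 1) * Y) =
      k * sphereIntegral d (linearForm x ^ (k - 1) * Y) +
        sphereIntegral d (linearForm x ^ k * dirDeriv x Y) := by
  have hself : dirDeriv x (linearForm x) = 1 := by
    rw [dirDeriv_linearForm]
    simp only [← sq, hx, map_one]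
  have h := sphereIntegral_linearForm_mul x ((isHomogeneous_linearForm_pow x k).mul hY)
  rw [Derivation.leibniz, Derivation.leibniz_pow, hself, map_add] at h
  simp only [smul_eq_mul, nsmul_eq_mul, mul_one, Nat.cast_add] at h
  rw [pow_succ', mul_assoc, h, add_comm, mul_left_comm, ← C_eq_coe_nat, sphereIntegral_C_mul,
    mul_comm Y]

theorem sphereIntegral_eq_zero_of_mem_harmonicSpace (hd : 2 ≤ d) (hn : n ≠ 0)
    (hY : Y ∈ harmonicSpace d n) : sphereIntegral d Y = 0 := by
  obtain ⟨hhom, hharm⟩ := mem_harmonicSpace.1 hY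
  have hdegree : ((n - 1 : ℕ) + d - 1 : ℝ) * n ≠ 0 := by
    have hd' : (2 : ℝ) ≤ d := mod_cast hd
    have : 0 < ((n - 1 : ℕ) : ℝ) + d - 1 := by linarith [(n - 1).cast_nonneg (α := ℝ)]
    positivity
  refine (mul_eq_zero_iff_left hdegree).1 ?_
  calc ((n - 1 : ℕ) + d - 1) * n * sphereIntegral d Y
    _ = ∑ i, ((n - 1 : ℕ) + d - 1) * sphereIntegral d (X i * pderiv i Y) := by
      rw [← Finset.mul_sum, ← map_sum, hhom.sum_X_mul_pderiv, map_nsmul, nsmul_eq_mul, mul_assoc]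
    _ = ∑ i, sphereIntegral d (pderiv i (pderiv i Y)) :=
      Finset.sum_congr rfl fun i _ => sphereIntegral_X_mul i hhom.pderiv
    _ = 0 := by rw [← map_sum, hharm, map_zero]

theorem sphereIntegral_eq_zonalMoment_zero_mul (hd : 2 ≤ d) (x : Fin d → ℝ)
    (hY : Y ∈ harmonicSpace d n) : sphereIntegral d Y = zonalMoment d n 0 * eval x Y := by
  obtain rfl | hn := eq_or_ne n 0
  · obtain ⟨c, rfl⟩ : ∃ c, Y = C c :=
      ⟨_, totalDegree_eq_zero_iff_eq_C.1 (Nat.le_zero.1 hY.1.totalDegree_le)⟩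
    rw [zonalMoment_zero_zero hd, eval_C, ← mul_one (C c), sphereIntegral_C_mul,
      sphereIntegral_one, mul_comm]
  · rw [zonalMoment_zero_right hd hn, zero_mul,
      sphereIntegral_eq_zero_of_mem_harmonicSpace hd hn hY]

theorem sphereIntegral_linearForm_pow_mul (hd : 2 ≤ d) (hx : ∑ i, x i ^ 2 = 1) (k : ℕ)
    (hY : Y ∈ harmonicSpace d n) :
    sphereIntegral d (linearForm x ^ k * Y) = zonalMoment d n k * eval x Y := by
  induction k using Nat.strong_induction_on generalizing n Y with
  | _ k ih =>
  cases k with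
  | zero => rw [pow_zero, one_mul, sphereIntegral_eq_zonalMoment_zero_mul hd x hY]
  | succ k =>
    have hdegree : (k + n + d - 1 : ℝ) ≠ 0 := by
      have hd' : (2 : ℝ) ≤ d := mod_cast hd
      have : 0 < (k + n + d - 1 : ℝ) := by
        linarith [k.cast_nonneg (α := ℝ), n.cast_nonneg (α := ℝ)]
      exact this.ne'
    refine mul_left_cancel₀ hdegree ?_
    calc (k + n + d - 1) * sphereIntegral d (linearForm x ^ (k + 1) * Y)
      _ = k * sphereIntegral d (linearForm x ^ (k - 1) * Y) +
          sphereIntegral d (linearForm x ^ k * dirDeriv x Y) :=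
        sphereIntegral_linearForm_pow_succ_mul hx k hY.1
      _ = k * (zonalMoment d n (k - 1) * eval x Y) +
          zonalMoment d (n - 1) k * (n * eval x Y) := by
        rw [ih (k - 1) (by omega) hY, ih k (by omega) (dirDeriv_mem_harmonicSpace x hY),
          eval_dirDeriv_self x hY.1]
      _ = (k * zonalMoment d n (k - 1) + n * zonalMoment d (n - 1) k) * eval x Y := by ring
      _ = (k + n + d - 1) * (zonalMoment d n (k + 1) * eval x Y) := by
        rw [← zonalMoment_succ hd, mul_assoc]

theorem sphereIntegral_aeval_linearForm_mul (hd : 2 ≤ d) (hx : ∑ i, x i ^ 2 = 1)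
    (hY : Y ∈ harmonicSpace d n) (p : Polynomial ℝ) :
    sphereIntegral d (p.aeval (linearForm x) * Y) =
      zonalIntegral d (p * zonalPoly d n) * eval x Y := by
  induction p using Polynomial.induction_on' with
  | add p q hp hq => simp only [map_add, add_mul, hp, hq]
  | monomial k a =>
    rw [← Polynomial.C_mul_X_pow_eq_monomial, ← Polynomial.smul_eq_C_mul, map_smul, map_pow,
      Polynomial.aeval_X, smul_mul_assoc, smul_mul_assoc, map_smul, map_smul,
      sphereIntegral_linearForm_pow_mul hd hx k hY, zonalMoment, smul_eq_mul, smul_eq_mul,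
      mul_assoc]

end SphereMoments

section Determinacy

open MeasureTheory Set

variable {a b : ℝ}

theorem measure_ext_of_integral_polynomial {ρ ρ' : Measure ℝ} [IsFiniteMeasure ρ]
    [IsFiniteMeasure ρ'] (hρ : ∀ᵐ t ∂ρ, t ∈ Icc a b) (hρ' : ∀ᵐ t ∂ρ', t ∈ Icc a b)
    (h : ∀ p : Polynomial ℝ, ∫ t, p.eval t ∂ρ = ∫ t, p.eval t ∂ρ') : ρ = ρ' := by
  refine ext_of_forall_integral_eq_of_IsFiniteMeasure fun g => ?_
  have hdist : ∀ {τ : Measure ℝ} [IsFiniteMeasure τ], (∀ᵐ t ∂τ, t ∈ Icc a b) →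
      ∀ {p : Polynomial ℝ} {ε : ℝ}, (∀ t ∈ Icc a b, |p.eval t - g t| < ε) →
        |∫ t, p.eval t ∂τ - ∫ t, g t ∂τ| ≤ ε * τ.real univ := fun {τ} _ hτ {p ε} hp => by
    rw [← integral_sub (integrable_eval_of_ae_mem_Icc hτ p) (g.integrable τ), ← Real.norm_eq_abs]
    exact norm_integral_le_of_norm_le_const (hτ.mono fun t ht => (hp t ht).le)
  refine eq_of_forall_dist_le fun ε hε => ?_
  set M := ρ.real univ + ρ'.real univ
  have : 0 ≤ M := by positivity
  obtain ⟨p, hp⟩ := exists_polynomial_near_of_continuousOn a b g g.continuous.continuousOn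
    (ε / (M + 1)) (by positivity)
  calc dist (∫ t, g t ∂ρ) (∫ t, g t ∂ρ')
    _ ≤ dist (∫ t, g t ∂ρ) (∫ t, p.eval t ∂ρ) + dist (∫ t, p.eval t ∂ρ) (∫ t, g t ∂ρ') :=
      dist_triangle _ _ _
    _ ≤ ε / (M + 1) * ρ.real univ + ε / (M + 1) * ρ'.real univ := by
      rw [dist_comm, Real.dist_eq, Real.dist_eq, h p]
      exact add_le_add (h p ▸ hdist hρ hp) (hdist hρ' hp)
    _ = ε * (M / (M + 1)) := by ring
    _ ≤ ε := mul_le_of_le_one_right hε.le ((div_le_one (by positivity)).2 (by linarith))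

theorem integral_withDensity_ofReal {α : Type*} [MeasurableSpace α] {ν : Measure α} {w : α → ℝ}
    (hw : Measurable w) (g : α → ℝ) :
    ∫ y, g y ∂ν.withDensity (fun y => ENNReal.ofReal (w y)) = ∫ y, g y * max (w y) 0 ∂ν := by
  rw [integral_withDensity_eq_integral_toReal_smul hw.ennreal_ofReal
    (.of_forall fun _ => ENNReal.ofReal_lt_top)]
  simp only [ENNReal.toReal_ofReal', smul_eq_mul, mul_comm]

theorem integral_comp_mul_eq_sub_withDensity {α : Type*} [MeasurableSpace α] {ν : Measure α}
    {φ w : α → ℝ} (hφ : Measurable φ) (hw : Measurable w) {g : ℝ → ℝ}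
    (hg : AEStronglyMeasurable g (ν.map φ)) (hg_int : Integrable (fun y => g (φ y) * w y) ν) :
    ∫ y, g (φ y) * w y ∂ν =
      ∫ t, g t ∂(ν.withDensity fun y => ENNReal.ofReal (w y)).map φ -
        ∫ t, g t ∂(ν.withDensity fun y => ENNReal.ofReal (-w y)).map φ := by
  have hmap : ∀ {u : α → ℝ}, Measurable u →
      ∫ t, g t ∂(ν.withDensity fun y => ENNReal.ofReal (u y)).map φ =
        ∫ y, g (φ y) * max (u y) 0 ∂ν := fun hu => by
    rw [integral_map hφ.aemeasurable
      (hg.mono_ac ((withDensity_absolutelyContinuous ν _).map hφ)),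
      integral_withDensity_ofReal hu]
  have hpart : ∀ {u : α → ℝ}, Measurable u → (∀ y, |u y| = |w y|) →
      Integrable (fun y => g (φ y) * max (u y) 0) ν := fun {u} hu huw => by
    refine hg_int.mono ((hg.comp_measurable hφ).mul
      (hu.max measurable_const).aestronglyMeasurable) (.of_forall fun y => ?_)
    rw [norm_mul, norm_mul, Real.norm_eq_abs (w y), ← huw y, Real.norm_eq_abs (max _ _),
      abs_of_nonneg (le_max_right _ _)]
    exact mul_le_mul_of_nonneg_left (max_le (le_abs_self _) (abs_nonneg _)) (norm_nonneg _)
  rw [hmap hw, hmap (u := fun y => -w y) hw.neg,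
    ← integral_sub (hpart hw fun _ => rfl)
      (hpart (u := fun y => -w y) hw.neg fun _ => abs_neg _)]
  simp only [← mul_sub, max_zero_sub_max_neg_zero_eq_self]

theorem integral_comp_mul_eq_zero_of_polynomial {α : Type*} [MeasurableSpace α] {ν : Measure α}
    {φ w : α → ℝ} (hφ : Measurable φ) (hφab : ∀ y, φ y ∈ Icc a b) (hw : Measurable w)
    (hw_int : Integrable w ν) (h : ∀ p : Polynomial ℝ, ∫ y, p.eval (φ y) * w y ∂ν = 0)
    {f : ℝ → ℝ} (hf : AEStronglyMeasurable f (ν.map φ))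
    (hf_int : Integrable (fun y => f (φ y) * w y) ν) : ∫ y, f (φ y) * w y ∂ν = 0 := by
  have := isFiniteMeasure_withDensity_ofReal hw_int.hasFiniteIntegral
  have := isFiniteMeasure_withDensity_ofReal hw_int.neg.hasFiniteIntegral
  have hsupp : ∀ ρ : Measure α, ∀ᵐ t ∂ρ.map φ, t ∈ Icc a b := fun ρ =>
    (ae_map_iff hφ.aemeasurable measurableSet_Icc).2 (.of_forall hφab)
  have hp_int : ∀ p : Polynomial ℝ, Integrable (fun y => p.eval (φ y) * w y) ν := fun p => by
    obtain ⟨B, hB⟩ := isCompact_Icc.exists_bound_of_continuousOn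
      (s := Icc a b) p.continuous.continuousOn
    exact hw_int.bdd_mul (c := B) (p.continuous.measurable.comp hφ).aestronglyMeasurable
      (.of_forall fun y => hB _ (hφab y))
  -- The images under `φ` of the positive and the negative part of `w ν` have the same moments.
  have hparts : (ν.withDensity fun y => ENNReal.ofReal (w y)).map φ =
      (ν.withDensity fun y => ENNReal.ofReal (-w y)).map φ :=
    measure_ext_of_integral_polynomial (hsupp _) (hsupp _) fun p => by
      rw [← sub_eq_zero, ← h p,
        integral_comp_mul_eq_sub_withDensity hφ hw p.continuous.aestronglyMeasurable (hp_int p)]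
  rw [integral_comp_mul_eq_sub_withDensity hφ hw hf hf_int, hparts, sub_self]

end Determinacy

section FunkHecke

open MvPolynomial MeasureTheory Set

variable {d n : ℕ}

theorem sum_sq_eq_one (x : unitSphere d) : ∑ i, x.1 i ^ 2 = 1 := by
  have h := EuclideanSpace.norm_sq_eq x.1
  rw [mem_sphere_zero_iff_norm.1 x.2] at h
  simpa using h.symm

theorem eval_linearForm (x y : EuclideanSpace ℝ (Fin d)) :
    eval (fun i => y i) (linearForm fun i => x i) = inner ℝ x y := by
  simp [linearForm, PiLp.inner_apply, mul_comm]

theorem eval_aeval_linearForm (x y : EuclideanSpace ℝ (Fin d)) (p : Polynomial ℝ) :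
    eval (fun i => y i) (p.aeval (linearForm fun i => x i)) = p.eval (inner ℝ x y) := by
  rw [← eval_linearForm]
  induction p using Polynomial.induction_on' with
  | add p q hp hq => simp [hp, hq]
  | monomial k a => simp [Polynomial.aeval_monomial, algebraMap_eq]

theorem measurable_inner_sphere (x : unitSphere d) :
    Measurable fun y : unitSphere d => inner ℝ x.1 y.1 :=
  Continuous.measurable (by fun_prop)

theorem inner_sphere_mem_Icc (x y : unitSphere d) : inner ℝ x.1 y.1 ∈ Icc (-1 : ℝ) 1 := by
  have h := abs_real_inner_le_norm x.1 y.1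
  rw [mem_sphere_zero_iff_norm.1 x.2, mem_sphere_zero_iff_norm.1 y.2, one_mul] at h
  exact abs_le.1 h

theorem sphereIntegral_aeval_linearForm (hd : 2 ≤ d) {x : Fin d → ℝ} (hx : ∑ i, x i ^ 2 = 1)
    (p : Polynomial ℝ) : sphereIntegral d (p.aeval (linearForm x)) = zonalIntegral d p := by
  simpa [zonalPoly_zero] using
    sphereIntegral_aeval_linearForm_mul hd hx (one_mem_harmonicSpace_zero d) p

theorem map_inner_surfaceMeasure (hd : 2 ≤ d) (x : unitSphere d) :
    (surfaceMeasure d).map (fun y : unitSphere d => inner ℝ x.1 y.1) = zonalMeasure d := by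
  have hm := measurable_inner_sphere x
  refine measure_ext_of_integral_polynomial
    ((ae_map_iff hm.aemeasurable measurableSet_Icc).2 (.of_forall (inner_sphere_mem_Icc x)))
    (ae_zonalMeasure_mem_Icc d) fun p => ?_
  rw [integral_map hm.aemeasurable p.continuous.aestronglyMeasurable, ← zonalIntegral_apply,
    ← sphereIntegral_aeval_linearForm hd (sum_sq_eq_one x), sphereIntegral_apply]
  simp only [eval_aeval_linearForm]

theorem integrable_comp_inner_mul_eval (hd : 2 ≤ d) (x : unitSphere d) {f : ℝ → ℝ}
    (hf : Integrable f (zonalMeasure d)) (q : MvPolynomial (Fin d) ℝ) :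
    Integrable (fun y : unitSphere d => f (inner ℝ x.1 y.1) * eval (fun i => y.1 i) q)
      (surfaceMeasure d) := by
  obtain ⟨M, hM⟩ := exists_forall_norm_eval_sphere_le q
  rw [← map_inner_surfaceMeasure hd x] at hf
  exact (hf.comp_measurable (measurable_inner_sphere x)).mul_bdd (c := M)
    (continuous_eval_sphere q).aestronglyMeasurable (.of_forall hM)

/-- The difference `Y - P_n(⟨x, ·⟩) Y(x)`, where `P_n` is the normalized Gegenbauer polynomial:
the part of the spherical harmonic `Y` that is orthogonal to all functions of `⟨x, ·⟩`. -/
noncomputable def zonalRemainder (n : ℕ) (x : Fin d → ℝ) (Y : MvPolynomial (Fin d) ℝ) :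
    MvPolynomial (Fin d) ℝ :=
  Y - C (eval x Y) * (zonalPoly d n).aeval (linearForm x)

theorem eval_zonalRemainder (n : ℕ) (x y : EuclideanSpace ℝ (Fin d)) (Y : MvPolynomial (Fin d) ℝ) :
    eval (fun i => y i) (zonalRemainder n (fun i => x i) Y) =
      eval (fun i => y i) Y - eval (fun i => x i) Y * (zonalPoly d n).eval (inner ℝ x y) := by
  rw [zonalRemainder, map_sub, map_mul, eval_aeval_linearForm, eval_C]

theorem sphereIntegral_aeval_linearForm_mul_zonalRemainder (hd : 2 ≤ d) {x : Fin d → ℝ}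
    (hx : ∑ i, x i ^ 2 = 1) {Y : MvPolynomial (Fin d) ℝ} (hY : Y ∈ harmonicSpace d n)
    (p : Polynomial ℝ) :
    sphereIntegral d (p.aeval (linearForm x) * zonalRemainder n x Y) = 0 := by
  rw [zonalRemainder, mul_sub, map_sub, mul_left_comm, ← map_mul, sphereIntegral_C_mul,
    sphereIntegral_aeval_linearForm hd hx, sphereIntegral_aeval_linearForm_mul hd hx hY, mul_comm,
    sub_self]

theorem integral_comp_inner_mul_eval_zonalRemainder (hd : 2 ≤ d) (x : unitSphere d)
    {Y : MvPolynomial (Fin d) ℝ} (hY : Y ∈ harmonicSpace d n) {f : ℝ → ℝ}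
    (hf : Integrable f (zonalMeasure d)) :
    ∫ y : unitSphere d, f (inner ℝ x.1 y.1) *
      eval (fun i => y.1 i) (zonalRemainder n (fun i => x.1 i) Y) ∂surfaceMeasure d = 0 := by
  refine integral_comp_mul_eq_zero_of_polynomial (measurable_inner_sphere x)
    (inner_sphere_mem_Icc x) (continuous_eval_sphere _).measurable (integrable_eval_sphere _)
    (fun p => ?_) (map_inner_surfaceMeasure hd x ▸ hf.aestronglyMeasurable)
    (integrable_comp_inner_mul_eval hd x hf _)
  rw [← sphereIntegral_aeval_linearForm_mul_zonalRemainder hd (sum_sq_eq_one x) hY p,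
    sphereIntegral_apply]
  simp only [map_mul, eval_aeval_linearForm]

theorem integral_comp_inner_mul_eval (hd : 2 ≤ d) (x : unitSphere d)
    {Y : MvPolynomial (Fin d) ℝ} (hY : Y ∈ harmonicSpace d n) {f : ℝ → ℝ}
    (hf : Integrable f (zonalMeasure d)) :
    ∫ y : unitSphere d, f (inner ℝ x.1 y.1) * eval (fun i => y.1 i) Y ∂surfaceMeasure d =
      (∫ t, f t * (zonalPoly d n).eval t ∂zonalMeasure d) * eval (fun i => x.1 i) Y := by
  have hm := measurable_inner_sphere x
  have hfP : AEStronglyMeasurable (fun t => f t * (zonalPoly d n).eval t) (zonalMeasure d) :=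
    hf.aestronglyMeasurable.mul (zonalPoly d n).continuous.aestronglyMeasurable
  have hfP_int : Integrable (fun y : unitSphere d => eval (fun i => x.1 i) Y *
      (f (inner ℝ x.1 y.1) * (zonalPoly d n).eval (inner ℝ x.1 y.1))) (surfaceMeasure d) := by
    simpa only [eval_aeval_linearForm] using
      (integrable_comp_inner_mul_eval hd x hf ((zonalPoly d n).aeval
        (linearForm fun i => x.1 i))).const_mul _
  have h := integral_comp_inner_mul_eval_zonalRemainder hd x hY hf
  simp only [eval_zonalRemainder, mul_sub, mul_left_comm (f _)] at h
  rw [integral_sub (integrable_comp_inner_mul_eval hd x hf Y) hfP_int, integral_const_mul,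
    sub_eq_zero] at h
  rw [h, mul_comm, ← map_inner_surfaceMeasure hd x, integral_map hm.aemeasurable]
  rwa [map_inner_surfaceMeasure hd x]

theorem integrableOn_mul_weight_of_abs {f : ℝ → ℝ}
    (hf_meas : AEStronglyMeasurable f (volume.restrict (Ioo (-1) 1)))
    (hf : IntegrableOn (fun t => |f t| * weight d t) (Ioo (-1) 1)) :
    IntegrableOn (fun t => f t * weight d t) (Ioo (-1) 1) :=
  Integrable.mono hf (hf_meas.mul (measurable_weight d).aestronglyMeasurable)
    (.of_forall fun t => by simp)

theorem integrableOn_mul_gegenbauerQuotient_mul_weight (hd : 2 ≤ d) (n : ℕ) {f : ℝ → ℝ}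
    (hf : IntegrableOn (fun t => f t * weight d t) (Ioo (-1) 1)) :
    IntegrableOn (fun t => f t * gegenbauerQuotient d n t * weight d t) (Ioo (-1) 1) := by
  simp only [← eval_zonalPoly hd, mul_right_comm (f _)]
  exact hf.mul_continuousOn_of_subset (zonalPoly d n).continuousOn measurableSet_Ioo isCompact_Icc
    Ioo_subset_Icc_self

theorem integral_mul_eval_zonalPoly (hd : 2 ≤ d) (n : ℕ) (f : ℝ → ℝ) :
    ∫ t, f t * (zonalPoly d n).eval t ∂zonalMeasure d = funkHeckeConstant d n f := by
  simp only [integral_zonalMeasure, eval_zonalPoly hd, funkHeckeConstant]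

end FunkHecke

end SphericalHarmonics

theorem mainTheorem5 (d : ℕ) (hd : 2 ≤ d) (f : ℝ → ℝ)
    (hf_meas : MeasureTheory.AEStronglyMeasurable f
      (MeasureTheory.volume.restrict (Set.Ioo (-1 : ℝ) 1)))
    (hf : MeasureTheory.IntegrableOn (fun t : ℝ => |f t| * SphericalHarmonics.weight d t)
      (Set.Ioo (-1 : ℝ) 1))
    (n : ℕ) :
    MeasureTheory.IntegrableOn
      (fun t : ℝ => f t * SphericalHarmonics.gegenbauerQuotient d n t *
        SphericalHarmonics.weight d t) (Set.Ioo (-1 : ℝ) 1) ∧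
    ∀ Y ∈ SphericalHarmonics.harmonicSpace d n, ∀ x : SphericalHarmonics.unitSphere d,
      MeasureTheory.Integrable
        (fun y : SphericalHarmonics.unitSphere d =>
          f (inner ℝ x.1 y.1) * MvPolynomial.eval (fun i => y.1 i) Y)
        (SphericalHarmonics.surfaceMeasure d) ∧
      ∫ y : SphericalHarmonics.unitSphere d,
          f (inner ℝ x.1 y.1) * MvPolynomial.eval (fun i => y.1 i) Y
            ∂(SphericalHarmonics.surfaceMeasure d) =
        SphericalHarmonics.funkHeckeConstant d n f * MvPolynomial.eval (fun i => x.1 i) Y := by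
  have hfw := SphericalHarmonics.integrableOn_mul_weight_of_abs hf_meas hf
  have hfz := SphericalHarmonics.integrable_zonalMeasure_of_integrableOn hfw
  refine ⟨SphericalHarmonics.integrableOn_mul_gegenbauerQuotient_mul_weight hd n hfw,
    fun Y hY x => ⟨SphericalHarmonics.integrable_comp_inner_mul_eval hd x hfz Y, ?_⟩⟩
  rw [SphericalHarmonics.integral_comp_inner_mul_eval hd x hY hfz,
    SphericalHarmonics.integral_mul_eval_zonalPoly hd]
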